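/- Let $r,n,s,f,A$ be integers with $n>0$, $r\ge 0$ and $f(r-s)\equiv 0 \pmod n$. Let $$E=E(r,n,s,A)=\langle t,y \mid t^n,\ y^r t^A y^{-s} t^{-A}\rangle ,$$ and let $\nu^f:E\to\langle t\mid t^n\rangle\cong\mathbb{Z}/n$ be the homomorphism with $\nu^f(t)=t$ and $\nu^f(y)=t^f$. For a word $w$ in the free group on $x_0,\dots,x_{n-1}$ (subscripts modulo $n$), with shift automorphism $\theta(x_i)=x_{i+1}$, let $G_n(w)=\langle x_0,\dots,x_{n-1}\mid w,\theta(w),\dots,\theta^{n-1}(w)\rangle$ be the cyclically presented group. Let $G=\ker\nu^f$, equivalently (up to isomorphism) $G=G_n(w)$ where $$w=\begin{cases}\prod_{i=0}^{r-1}x_{if}\Bigl(\prod_{i=0}^{s-1}x_{A+if}\Bigr)^{-1} & \text{if } s\ge 0,\\[4pt] \prod_{i=0}^{r-1}x_{if}\,\prod_{i=0}^{|s|-1}x_{A+(r+i)f} & \text{if } s<0.\end{cases}$$ Call a group large if it has a subgroup of finite index that surjects onto the free group $F_2$ of rank two, and virtually abelian if it has an abelian subgroup of finite index. Then $E$ is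 large or virtually abelian, and $G$ (in either description) is large or virtually abelian. Consequently every group of type $\mathfrak{M}$ is large or virtually abelian, where a group is of type $\mathfrak{M}$ if it is isomorphic to $G_n(w)$ for some $n>0$ and some $w=\Lambda(r_1,f)\,\theta^a(\Lambda(r_2,f))^{\varepsilon}$ with $r_1,r_2\ge 0$, $f\in\mathbb{Z}$, $0\le a\le n-1$, $\varepsilon=\pm1$ and $(r_1+\varepsilon r_2)f\equiv 0\pmod n$; here $\Lambda(r,f)=\prod_{i=0}^{r-1}x_{if}$. -/

import Mathlib

namespace CycPres

/-- The shift automorphism `θ` of the free group on `x_i`, `i ∈ ℤ/n`, with `θ(x_i) = x_{i+1}`. -/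
def shift (n : ℕ) : MulAut (FreeGroup (ZMod n)) :=
  FreeGroup.freeGroupCongr (Equiv.addRight (1 : ZMod n))

/-- The relators `w, θ(w), …, θ^{n-1}(w)`. -/
def relators (n : ℕ) (w : FreeGroup (ZMod n)) : Set (FreeGroup (ZMod n)) :=
  {v | ∃ i : ℕ, i < n ∧ v = (shift n ^ i) w}

/-- The cyclically presented group `G_n(w)`. -/
abbrev CycPresGroup (n : ℕ) (w : FreeGroup (ZMod n)) : Type :=
  PresentedGroup (relators n w)

/-- The word `Λ(r, f) = x_0 x_f x_{2f} ⋯ x_{(r-1)f}`. -/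
def block (n r : ℕ) (f : ℤ) : FreeGroup (ZMod n) :=
  ((List.range r).map fun i => FreeGroup.of (((i : ℤ) * f : ℤ) : ZMod n)).prod

/-- `G` is of type `𝔐`: it is isomorphic to `G_n(w)` for a word
`w = Λ(r₁, f) · θ^a(Λ(r₂, f))^ε` with `ε = ±1` and `(r₁ + ε r₂) f ≡ 0 mod n`. -/
def IsTypeM (G : Type*) [Group G] : Prop :=
  ∃ (n r₁ r₂ a : ℕ) (f : ℤ) (ε : ℤˣ), 0 < n ∧ a < n ∧
    ((r₁ : ℤ) + (ε : ℤ) * r₂) * f ≡ 0 [ZMOD n] ∧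
    Nonempty (G ≃* CycPresGroup n (block n r₁ f * ((shift n ^ a) (block n r₂ f)) ^ (ε : ℤ)))

/-- The word defining the group of type `𝔐` with parameters `(r, n, s, f, A)`:
`∏_{i<r} x_{if} (∏_{i<s} x_{A+if})⁻¹` if `s ≥ 0`, and
`∏_{i<r} x_{if} ∏_{i<|s|} x_{A+(r+i)f}` if `s < 0`. -/
def wordM (r n : ℕ) (s f A : ℤ) : FreeGroup (ZMod n) :=
  if 0 ≤ s then block n r f * ((shift n ^ A) (block n s.natAbs f))⁻¹
  else block n r f * (shift n ^ (A + f * r)) (block n s.natAbs f)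

/-- The two generators of the shift extension. -/
inductive Gen
  | t
  | y

/-- The relators `t^n` and `y^r t^A y^{-s} t^{-A}`. -/
def extRelators (r : ℤ) (n : ℕ) (s A : ℤ) : Set (FreeGroup Gen) :=
  {FreeGroup.of Gen.t ^ n,
    FreeGroup.of Gen.y ^ r * FreeGroup.of Gen.t ^ A *
      FreeGroup.of Gen.y ^ (-s) * FreeGroup.of Gen.t ^ (-A)}

/-- The group `E(r, n, s, A) = ⟨t, y | t^n, y^r t^A y^{-s} t^{-A}⟩`. -/
abbrev ExtGroup (r : ℤ) (n : ℕ) (s A : ℤ) : Type :=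
  PresentedGroup (extRelators r n s A)

/-- The images of the generators under `ν^f`; the cyclic group `⟨t | t^n⟩` is written as
`ℤ/n` in multiplicative notation, `t` being the class of `1`. -/
def retractionGen (n : ℕ) (f : ℤ) : Gen → Multiplicative (ZMod n)
  | Gen.t => Multiplicative.ofAdd 1
  | Gen.y => Multiplicative.ofAdd (f : ZMod n)

theorem retractionGen_relators {r : ℤ} {n : ℕ} {s f : ℤ} (A : ℤ)
    (h : f * (r - s) ≡ 0 [ZMOD n]) :
    ∀ w ∈ extRelators r n s A, FreeGroup.lift (retractionGen n f) w = 1 := by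
  have h' : (f : ZMod n) * ((r : ZMod n) - s) = 0 := by
    have := (ZMod.intCast_eq_intCast_iff _ _ n).2 h
    push_cast at this
    exact this
  intro w hw
  rcases hw with rfl | rfl
  · simp [retractionGen, ← ofAdd_nsmul]
  · simp only [map_mul, map_zpow, FreeGroup.lift_apply_of, retractionGen, ← ofAdd_zsmul,
      ← ofAdd_add]
    rw [← ofAdd_zero]
    congr 1
    simp only [zsmul_eq_mul]
    push_cast
    linear_combination h'

/-- The retraction `ν^f : E → ⟨t | t^n⟩` with `ν^f(t) = t` and `ν^f(y) = t^f`. -/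
def retraction {r : ℤ} {n : ℕ} {s f : ℤ} (A : ℤ) (h : f * (r - s) ≡ 0 [ZMOD n]) :
    ExtGroup r n s A →* Multiplicative (ZMod n) :=
  PresentedGroup.toGroup (retractionGen_relators A h)

/-- A group is large if a subgroup of finite index surjects onto the free group of rank two. -/
def IsLarge (G : Type*) [Group G] : Prop :=
  ∃ H : Subgroup G, H.FiniteIndex ∧ ∃ φ : H →* FreeGroup (Fin 2), Function.Surjective φ

/-- A group is virtually abelian if it has an abelian subgroup of finite index. -/
def IsVirtuallyAbelian (G : Type*) [Group G] : Prop :=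
  ∃ H : Subgroup G, H.FiniteIndex ∧ ∀ a ∈ H, ∀ b ∈ H, a * b = b * a

end CycPres

/-!
Write `n = d m` and `A = d B` with `B` prime to `m`. When `r` and `s` are coprime, the relation
`t^A y^s t^{-A} = y^r` iterated `m` times gives `y^D = 1` for `D = r^m - s^m`. If `N ∣ D`, then `E`
acts on `ℤ/n × ℤ/N` with `t` rotating the first coordinate and `y` shearing the second, by an amount
which is multiplied by `s/r` under translation by `A`. Conjugating the shear by an `F₂`-valued
labelling that is `d`-periodic in the first coordinate lifts this action to the wreath product of
`F₂` with the symmetric group. At the base point, suitable commutators of powers of `t` and `y` are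
labelled by a single value of the labelling. So `E` is large as soon as a `d × N` grid has room for
both generators of `F₂` away from its axes, that is `d, N ≥ 2` and not both equal to `2`. In the
remaining cases `d = 1`, `D = ±1`, or `d = 2` and `D = ±2`, there is a normal cyclic subgroup whose
quotient is cyclic or generated by two involutions. If `gcd(r, s) = k ≠ 1`, then `E` maps onto
`ℤ/n * ℤ/k`, which leaves `n = 1` and `n = k = 2`; in the latter case `E` acts on `ℤ/2 × ℤ/N`, with
`N ∣ r - s`, when `A` is even, and `⟨y^2⟩` is normal when `A` is odd.

The group `E` is also the semidirect product of `G_n(w)` with `ℤ/n` acting by the shift, with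
`x_0 = y t^{-f}`, so `G_n(w)` is the kernel of `ν^f`. Both properties pass to subgroups of finite
index, largeness because of the Nielsen–Schreier theorem.
-/

namespace CycPres

section Large

variable {G K : Type*} [Group G] [Group K]

theorem finiteIndex_comap (ψ : K →* G) (H : Subgroup G) [hH : H.FiniteIndex] :
    (H.comap ψ).FiniteIndex := by
  refine ⟨?_⟩
  rw [Subgroup.index_comap]
  exact fun h => hH.index_ne_zero (Subgroup.index_eq_zero_of_relIndex_eq_zero h)

-- The generators map to the standard upper and lower unipotent matrices.
theorem not_commute_of_zero_pow_of_one_pow {i j : ℕ} (hi : i ≠ 0) (hj : j ≠ 0) :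
    ¬ Commute (FreeGroup.of (0 : Fin 2) ^ i) (FreeGroup.of (1 : Fin 2) ^ j) := by
  intro hcomm
  have hSL := hcomm.map (FreeGroup.lift
    ![ModularGroup.T, ModularGroup.S * ModularGroup.T * ModularGroup.S⁻¹])
  simp only [map_pow, FreeGroup.lift_apply_of, conj_pow, Matrix.cons_val_zero,
    Matrix.cons_val_one] at hSL
  have hT (k : ℕ) : ((ModularGroup.T ^ k : Matrix.SpecialLinearGroup (Fin 2) ℤ) :
      Matrix (Fin 2) (Fin 2) ℤ) = !![1, (k : ℤ); 0, 1] := by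
    rw [← zpow_natCast, ModularGroup.coe_T_zpow]
  have hentry := congrArg (fun g : Matrix.SpecialLinearGroup (Fin 2) ℤ =>
    (g : Matrix (Fin 2) (Fin 2) ℤ) 0 0) hSL.eq
  simp only [Matrix.SpecialLinearGroup.coe_mul, hT, ModularGroup.coe_S,
    Matrix.SpecialLinearGroup.coe_inv] at hentry
  simp [Matrix.mul_apply, Fin.sum_univ_two, Matrix.adjugate_fin_two, hi, hj] at hentry

theorem freeGroup_commute_of_subsingleton {α : Type*} [Subsingleton α] (x y : FreeGroup α) :
    Commute x y := by
  rcases isEmpty_or_nonempty α with _ | ⟨⟨i⟩⟩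
  · exact Subsingleton.elim _ _
  · have : Unique α := uniqueOfSubsingleton i
    exact IsCyclic.commGroup.mul_comm x y

theorem exists_surjective_freeGroup_two_of_not_commute {F : Type*} [Group F] [IsFreeGroup F]
    {a b : F} (hab : ¬ Commute a b) :
    ∃ φ : F →* FreeGroup (Fin 2), Function.Surjective φ := by
  classical
  obtain ⟨ι, ⟨β⟩⟩ := IsFreeGroup.nonempty_basis (G := F)
  have hι : Nontrivial ι := by
    by_contra hι
    have := not_nontrivial_iff_subsingleton.1 hι
    exact hab <| by
      simpa using (freeGroup_commute_of_subsingleton (β.repr a) (β.repr b)).map β.repr.symm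
  obtain ⟨i, j, hij⟩ := hι
  have hsurj : Function.Surjective fun k => if k = i then (0 : Fin 2) else 1 := by
    intro k
    fin_cases k
    · exact ⟨i, by simp⟩
    · exact ⟨j, by simp [hij.symm]⟩
  exact ⟨(FreeGroup.map fun k => if k = i then 0 else 1).comp β.repr.toMonoidHom,
    (FreeGroup.map_surjective hsurj).comp β.repr.surjective⟩

-- By Nielsen–Schreier the image of `φ` is again free.
theorem isLarge_of_not_commute {H : Subgroup G} [H.FiniteIndex] {F : Type*} [Group F]
    [IsFreeGroup F] (φ : H →* F) {a b : H} (hab : ¬ Commute (φ a) (φ b)) : IsLarge G := by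
  have hab' : ¬ Commute (φ.rangeRestrict a) (φ.rangeRestrict b) :=
    fun h => hab (h.map φ.range.subtype)
  obtain ⟨q, hq⟩ := exists_surjective_freeGroup_two_of_not_commute hab'
  exact ⟨H, inferInstance, q.comp φ.rangeRestrict, hq.comp φ.rangeRestrict_surjective⟩

theorem IsLarge.of_surjective {ψ : G →* K} (hψ : Function.Surjective ψ) (h : IsLarge K) :
    IsLarge G := by
  obtain ⟨H, _, φ, hφ⟩ := h
  exact ⟨H.comap ψ, finiteIndex_comap ψ H, φ.comp (ψ.subgroupComap H),
    hφ.comp (MonoidHom.subgroupComap_surjective_of_surjective ψ H hψ)⟩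

theorem IsLarge.subgroup (h : IsLarge G) (K : Subgroup G) [hK : K.FiniteIndex] :
    IsLarge K := by
  obtain ⟨H, _, φ, hφ⟩ := h
  have hpow (x : FreeGroup (Fin 2)) : ∃ k : H.comap K.subtype, ∃ i : ℕ, i ≠ 0 ∧
      φ (K.subtype.subgroupComap H k) = x ^ i := by
    obtain ⟨g, rfl⟩ := hφ x
    obtain ⟨i, hi, -, hgK⟩ := Subgroup.exists_pow_mem_of_index_ne_zero hK.index_ne_zero (g : G)
    exact ⟨⟨⟨_, hgK⟩, H.pow_mem g.2 i⟩, i, hi.ne', map_pow φ g i⟩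
  obtain ⟨a, i, hi, ha⟩ := hpow (FreeGroup.of 0)
  obtain ⟨b, j, hj, hb⟩ := hpow (FreeGroup.of 1)
  have : (H.comap K.subtype).FiniteIndex := finiteIndex_comap K.subtype H
  refine isLarge_of_not_commute (φ.comp (K.subtype.subgroupComap H)) (a := a) (b := b) ?_
  rw [MonoidHom.comp_apply, MonoidHom.comp_apply, ha, hb]
  exact not_commute_of_zero_pow_of_one_pow hi hj

theorem IsVirtuallyAbelian.of_injective {ι : K →* G} (hι : Function.Injective ι)
    (h : IsVirtuallyAbelian G) : IsVirtuallyAbelian K := by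
  obtain ⟨H, _, hcomm⟩ := h
  refine ⟨H.comap ι, finiteIndex_comap ι H, fun a ha b hb => hι ?_⟩
  rw [map_mul, map_mul]
  exact hcomm _ ha _ hb

theorem isLarge_or_isVirtuallyAbelian_subgroup (h : IsLarge G ∨ IsVirtuallyAbelian G)
    (K : Subgroup G) [K.FiniteIndex] : IsLarge K ∨ IsVirtuallyAbelian K :=
  h.imp (·.subgroup K) (.of_injective K.subtype_injective)

theorem isLarge_or_isVirtuallyAbelian_congr (e : K ≃* G) :
    IsLarge K ∨ IsVirtuallyAbelian K ↔ IsLarge G ∨ IsVirtuallyAbelian G :=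
  ⟨.imp (.of_surjective (ψ := e.symm.toMonoidHom) e.symm.surjective)
    (.of_injective (ι := e.symm.toMonoidHom) e.symm.injective),
  .imp (.of_surjective (ψ := e.toMonoidHom) e.surjective)
    (.of_injective (ι := e.toMonoidHom) e.injective)⟩

end Large

section VirtuallyAbelian

open Subgroup

variable {G : Type*} [Group G]

theorem mem_normalizer_zpowers_iff {g c : G} :
    g ∈ normalizer (zpowers c : Set G) ↔ zpowers (g * c * g⁻¹) = zpowers c := by
  rw [mem_normalizer_iff_map_conj_eq, MonoidHom.map_zpowers]
  rfl

theorem mem_normalizer_zpowers_of_commute {g c : G} (h : Commute g c) :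
    g ∈ normalizer (zpowers c : Set G) := by
  rw [mem_normalizer_zpowers_iff, h.eq, mul_inv_cancel_right]

theorem normal_of_closure_eq_top {S : Set G} (hS : closure S = ⊤) {H : Subgroup G}
    (hH : S ⊆ normalizer (H : Set G)) : H.Normal :=
  normalizer_eq_top_iff.1 <| top_le_iff.1 <| hS ▸ (closure_le _).2 hH

theorem zpowers_mk_eq_top {a b : G} (hab : closure {a, b} = ⊤) {N : Subgroup G} [N.Normal]
    (hb : b ∈ N) : zpowers (a : G ⧸ N) = ⊤ := by
  refine top_le_iff.1 ?_
  rw [← MonoidHom.range_eq_top.2 (QuotientGroup.mk'_surjective N), MonoidHom.range_eq_map, ← hab,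
    MonoidHom.map_closure, closure_le]
  rintro _ ⟨g, rfl | rfl, rfl⟩
  · exact mem_zpowers _
  · rw [QuotientGroup.mk'_apply, (QuotientGroup.eq_one_iff g).2 hb]
    exact one_mem _

theorem finite_mulAut_of_isCyclic [IsCyclic G] : Finite (MulAut G) := by
  have : Finite (ZMod (Nat.card G))ˣ := by
    cases Nat.card G
    · exact inferInstanceAs (Finite ℤˣ)
    · infer_instance
  exact Finite.of_equiv _ (IsCyclic.mulAutMulEquiv G).symm.toEquiv

theorem finiteIndex_centralizer_of_isCyclic (N : Subgroup G) [N.Normal] [IsCyclic N] :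
    (centralizer (N : Set G)).FiniteIndex := by
  have := finite_mulAut_of_isCyclic (G := N)
  refine finiteIndex_of_le (H := (MulAut.conjNormal (H := N)).ker) fun g hg c hc => ?_
  have hconj := congrArg Subtype.val (DFunLike.congr_fun (MonoidHom.mem_ker.1 hg) ⟨c, hc⟩)
  exact (mul_inv_eq_iff_eq_mul.1 hconj).symm

theorem isVirtuallyAbelian_of_isCyclic_of_isCyclic (N : Subgroup G) [N.Normal] [IsCyclic N]
    (C : Subgroup (G ⧸ N)) [C.FiniteIndex] [IsCyclic C] : IsVirtuallyAbelian G := by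
  have := finiteIndex_centralizer_of_isCyclic N
  have := finiteIndex_comap (QuotientGroup.mk' N) C
  let H := C.comap (QuotientGroup.mk' N) ⊓ centralizer (N : Set G)
  let f : H →* C := ((QuotientGroup.mk' N).comp H.subtype).codRestrict C fun g => g.2.1
  have hf : f.ker ≤ center H := by
    intro x hx
    have hxN : (x : G) ∈ N := (QuotientGroup.eq_one_iff _).1 (congrArg Subtype.val hx)
    exact mem_center_iff.2 fun g => Subtype.ext (g.2.2 x hxN).symm
  refine ⟨H, inferInstance, fun a ha b hb => ?_⟩
  have := f.isMulCommutative_of_isCyclic_of_ker_le_center hf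
  exact congrArg Subtype.val (mul_comm' (⟨a, ha⟩ : H) ⟨b, hb⟩)

theorem isVirtuallyAbelian_of_normal_zpowers {a b : G} (hab : closure {a, b} = ⊤)
    (hb : (zpowers b).Normal) : IsVirtuallyAbelian G := by
  have : IsCyclic (G ⧸ zpowers b) :=
    isCyclic_iff_exists_zpowers_eq_top.2 ⟨_, zpowers_mk_eq_top hab (mem_zpowers b)⟩
  exact isVirtuallyAbelian_of_isCyclic_of_isCyclic (zpowers b) ⊤

theorem finiteIndex_zpowers_mul_of_sq_eq_one {a b : G} (hab : closure {a, b} = ⊤)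
    (ha : a ^ 2 = 1) (hb : b ^ 2 = 1) : (zpowers (a * b)).FiniteIndex := by
  have ha' : a⁻¹ = a := inv_eq_of_mul_eq_one_left (sq a ▸ ha)
  have hb' : b⁻¹ = b := inv_eq_of_mul_eq_one_left (sq b ▸ hb)
  have : (zpowers (a * b)).Normal := by
    refine normal_of_closure_eq_top hab fun g hg => mem_normalizer_zpowers_iff.2 ?_
    rw [← zpowers_inv (g := a * b), mul_inv_rev, ha', hb']
    rcases hg with rfl | rfl
    · rw [← mul_assoc, ← sq, ha, one_mul, ha']
    · rw [hb', mul_assoc, mul_assoc, ← sq, hb, mul_one]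
  have hgen : closure {b, a * b} = ⊤ := by
    rw [← top_le_iff, ← hab, closure_le, Set.pair_subset_iff]
    have hb_mem : b ∈ closure {b, a * b} := subset_closure (by simp)
    have hab_mem : a * b ∈ closure {b, a * b} := subset_closure (by simp)
    exact ⟨by simpa using mul_mem hab_mem (inv_mem hb_mem), hb_mem⟩
  have hfin : Finite (zpowers (b : G ⧸ zpowers (a * b))) := by
    refine finite_zpowers.2 (isOfFinOrder_iff_pow_eq_one.2 ⟨2, two_pos, ?_⟩)
    rw [← QuotientGroup.mk_pow, hb, QuotientGroup.mk_one]
  rw [zpowers_mk_eq_top hgen (mem_zpowers _)] at hfin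
  have : Finite (G ⧸ zpowers (a * b)) := Finite.of_equiv _ topEquiv.toEquiv
  exact finiteIndex_of_finite_quotient

theorem isVirtuallyAbelian_of_sq_mem_zpowers {a b c : G} (hab : closure {a, b} = ⊤)
    (hc : (zpowers c).Normal) (ha : a ^ 2 ∈ zpowers c) (hb : b ^ 2 ∈ zpowers c) :
    IsVirtuallyAbelian G := by
  have hquot : closure {(a : G ⧸ zpowers c), (b : G ⧸ zpowers c)} = ⊤ := by
    have := congrArg (map (QuotientGroup.mk' (zpowers c))) hab
    rwa [MonoidHom.map_closure, Set.image_pair,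
      map_top_of_surjective _ (QuotientGroup.mk'_surjective _)] at this
  have := finiteIndex_zpowers_mul_of_sq_eq_one hquot
    ((QuotientGroup.eq_one_iff _).2 ha) ((QuotientGroup.eq_one_iff _).2 hb)
  exact isVirtuallyAbelian_of_isCyclic_of_isCyclic (zpowers c)
    (zpowers ((a : G ⧸ zpowers c) * b))

end VirtuallyAbelian

section SemiconjBy

open Subgroup

variable {G : Type*} [Group G]

theorem isCoprime_pow_sub_pow {r s : ℤ} (hrs : IsCoprime r s) {m : ℕ} (hm : m ≠ 0) :
    IsCoprime r (r ^ m - s ^ m) ∧ IsCoprime s (r ^ m - s ^ m) := by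
  obtain ⟨m, rfl⟩ := Nat.exists_eq_succ_of_ne_zero hm
  constructor
  · rw [Nat.succ_eq_add_one, pow_succ' r, sub_eq_neg_add, IsCoprime.add_mul_left_right_iff]
    exact hrs.pow_right.neg_right
  · rw [Nat.succ_eq_add_one, pow_succ' s, sub_eq_add_neg, ← mul_neg,
      IsCoprime.add_mul_left_right_iff]
    exact hrs.symm.pow_right

theorem zpowers_zpow_eq_of_isCoprime {x : G} {N k : ℤ} (hx : x ^ N = 1) (hk : IsCoprime k N) :
    zpowers (x ^ k) = zpowers x := by
  obtain ⟨a, b, hab⟩ := hk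
  refine le_antisymm (zpowers_le.2 (zpow_mem (mem_zpowers x) k)) (zpowers_le.2 ⟨a, ?_⟩)
  change (x ^ k) ^ a = x
  rw [← zpow_mul, mul_comm, eq_sub_of_add_eq hab, mul_comm, zpow_sub, zpow_mul, hx, one_zpow,
    inv_one, mul_one, zpow_one]

theorem semiconjBy_pow_zpow_pow {u x : G} {r s : ℤ} (h : SemiconjBy u (x ^ s) (x ^ r)) (k : ℕ) :
    SemiconjBy (u ^ k) (x ^ s ^ k) (x ^ r ^ k) := by
  induction k with
  | zero => simp
  | succ k ih =>
    have hu : SemiconjBy u (x ^ s ^ (k + 1)) (x ^ (r * s ^ k)) := by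
      simpa only [← zpow_mul, ← pow_succ'] using h.zpow_right (s ^ k)
    have huk : SemiconjBy (u ^ k) (x ^ (r * s ^ k)) (x ^ r ^ (k + 1)) := by
      simpa only [← zpow_mul, mul_comm _ r, ← pow_succ'] using ih.zpow_right r
    rw [pow_succ u]
    exact huk.mul_left hu

theorem zpow_pow_sub_pow_eq_one {u x : G} {r s : ℤ} (h : SemiconjBy u (x ^ s) (x ^ r)) {m : ℕ}
    (hu : u ^ m = 1) : x ^ (r ^ m - s ^ m) = 1 := by
  have hm : x ^ s ^ m = x ^ r ^ m := by
    simpa only [hu, SemiconjBy, one_mul, mul_one] using semiconjBy_pow_zpow_pow h m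
  rw [zpow_sub, hm, mul_inv_cancel]

theorem mem_normalizer_zpowers_of_semiconjBy {u x : G} {r s : ℤ} (hrs : IsCoprime r s)
    (h : SemiconjBy u (x ^ s) (x ^ r)) (hu : IsOfFinOrder u) :
    u ∈ normalizer (zpowers x : Set G) := by
  obtain ⟨m, hm, hum⟩ := isOfFinOrder_iff_pow_eq_one.1 hu
  have hx := zpow_pow_sub_pow_eq_one h hum
  obtain ⟨hr, hs⟩ := isCoprime_pow_sub_pow hrs hm.ne'
  have hxs := zpowers_zpow_eq_of_isCoprime hx hs
  have hconj : u * x ^ s * u⁻¹ = x ^ r := mul_inv_eq_iff_eq_mul.2 h.eq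
  rw [← hxs, mem_normalizer_zpowers_iff, hconj, hxs, zpowers_zpow_eq_of_isCoprime hx hr]

end SemiconjBy

namespace ExtGroup

open Subgroup

theorem relator_eq_one_iff {Γ : Type*} [Group Γ] {u x : Γ} {r s : ℤ} :
    x ^ r * u * x ^ (-s) * u⁻¹ = 1 ↔ SemiconjBy u (x ^ s) (x ^ r) := by
  rw [mul_inv_eq_one, zpow_neg, mul_inv_eq_iff_eq_mul, eq_comm, SemiconjBy]

variable {Γ : Type*} [Group Γ] {r : ℤ} {n : ℕ} {s A : ℤ}

/-- The generator `t` of `E(r, n, s, A)`. -/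
def t : ExtGroup r n s A := PresentedGroup.of Gen.t

/-- The generator `y` of `E(r, n, s, A)`. -/
def y : ExtGroup r n s A := PresentedGroup.of Gen.y

theorem t_pow : (t : ExtGroup r n s A) ^ n = 1 :=
  PresentedGroup.one_of_mem (rels := extRelators r n s A) (Or.inl rfl)

theorem t_zpow : (t : ExtGroup r n s A) ^ (n : ℤ) = 1 := by
  rw [zpow_natCast, t_pow]

theorem semiconjBy_t_zpow : SemiconjBy (t ^ A) (y ^ s) (y ^ r : ExtGroup r n s A) := by
  rw [← relator_eq_one_iff, ← zpow_neg]
  exact PresentedGroup.one_of_mem (rels := extRelators r n s A) (Or.inr rfl)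

theorem closure_t_y : closure {(t : ExtGroup r n s A), y} = ⊤ := by
  rw [← PresentedGroup.closure_range_of]
  congr 1
  ext g
  constructor
  · rintro (rfl | rfl)
    exacts [⟨Gen.t, rfl⟩, ⟨Gen.y, rfl⟩]
  · rintro ⟨_ | _, rfl⟩
    exacts [Or.inl rfl, Or.inr rfl]

/-- The homomorphism `t ↦ a`, `y ↦ b` given by the universal property of `E(r, n, s, A)`. -/
def lift (a b : Γ) (ha : a ^ n = 1) (hb : SemiconjBy (a ^ A) (b ^ s) (b ^ r)) :
    ExtGroup r n s A →* Γ :=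
  PresentedGroup.toGroup (f := fun | Gen.t => a | Gen.y => b) <| by
    rintro _ (rfl | rfl)
    · simpa using ha
    · simpa only [map_mul, map_zpow, FreeGroup.lift_apply_of, zpow_neg a]
        using relator_eq_one_iff.2 hb

section Lift

variable {a b : Γ} {ha : a ^ n = 1} {hb : SemiconjBy (a ^ A) (b ^ s) (b ^ r)}

@[simp]
theorem lift_t : lift a b ha hb t = a := PresentedGroup.toGroup.of _

@[simp]
theorem lift_y : lift a b ha hb y = b := PresentedGroup.toGroup.of _

theorem lift_surjective (hab : closure {a, b} = ⊤) : Function.Surjective (lift a b ha hb) := by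
  rw [← MonoidHom.range_eq_top, ← top_le_iff, ← hab, closure_le, Set.pair_subset_iff]
  exact ⟨⟨t, lift_t⟩, ⟨y, lift_y⟩⟩

end Lift

theorem hom_ext {φ ψ : ExtGroup r n s A →* Γ} (ht : φ t = ψ t) (hy : φ y = ψ y) : φ = ψ := by
  ext (_ | _)
  exacts [ht, hy]

end ExtGroup

/-- The permutational wreath product `F ≀ Perm X`: pairs of a labelling of `X` by `F` and a
permutation of `X`. -/
abbrev Wreath (X F : Type*) [Group F] : Type _ :=
  (X → F) ⋊[mulAutArrow] Equiv.Perm X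

namespace Wreath

variable {X F : Type*} [Group F]

theorem mul_left_apply (g h : Wreath X F) (x : X) :
    (g * h).left x = g.left x * h.left (g.right⁻¹ x) := rfl

variable (F) in
/-- The permutations fixing `x₀`, with arbitrary labels. -/
def stabilizer (x₀ : X) : Subgroup (Wreath X F) :=
  (MulAction.stabilizer (Equiv.Perm X) x₀).comap SemidirectProduct.rightHom

theorem mem_stabilizer {x₀ : X} {g : Wreath X F} : g ∈ stabilizer F x₀ ↔ g.right x₀ = x₀ :=
  Iff.rfl

/-- The label at a fixed point. -/
def labelHom (x₀ : X) : stabilizer F x₀ →* F where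
  toFun g := g.1.left x₀
  map_one' := rfl
  map_mul' g h := by
    have hx : g.1.right⁻¹ x₀ = x₀ := Equiv.Perm.inv_eq_iff_eq.2 (mem_stabilizer.1 g.2).symm
    rw [Subgroup.coe_mul, mul_left_apply, hx]

theorem isLarge_of_hom [Finite X] {G : Type*} [Group G] (ρ : G →* Wreath X (FreeGroup (Fin 2)))
    (x₀ : X) (hρ : ∀ k, ∃ g, (ρ g).right x₀ = x₀ ∧ (ρ g).left x₀ = FreeGroup.of k) :
    IsLarge G := by
  have : (stabilizer (FreeGroup (Fin 2)) x₀).FiniteIndex := finiteIndex_comap _ _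
  refine ⟨_, finiteIndex_comap ρ (stabilizer _ x₀), (labelHom x₀).comp (ρ.subgroupComap _), ?_⟩
  rw [← MonoidHom.range_eq_top, ← top_le_iff, ← FreeGroup.closure_range_of, Subgroup.closure_le]
  rintro _ ⟨k, rfl⟩
  obtain ⟨g, hfix, hlabel⟩ := hρ k
  exact ⟨⟨g, hfix⟩, hlabel⟩

end Wreath

/-- The shear `(i, j) ↦ (i, j + κ i)`; shears compose by adding the functions `κ`. -/
def shear {I J : Type*} [AddCommGroup J] : Multiplicative (I → J) →* Equiv.Perm (I × J) where
  toFun κ := Equiv.prodShear (Equiv.refl I) fun i => Equiv.addRight (κ.toAdd i)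
  map_one' := by ext <;> simp
  map_mul' κ μ := by ext <;> simp [add_comm (μ.toAdd _), add_assoc]

theorem shear_zpow_apply {I J : Type*} [AddCommGroup J] (κ : I → J) (k : ℤ) (x : I × J) :
    (shear (.ofAdd κ) ^ k) x = (x.1, x.2 + k • κ x.1) := by
  rw [← map_zpow, ← ofAdd_zsmul]
  rfl

/-- The translation of the first coordinate by `1`. -/
def rotation (I J : Type*) [AddGroupWithOne I] [AddGroup J] : Equiv.Perm (I × J) :=
  Equiv.addRight (1, 0)

theorem rotation_zpow_apply {I J : Type*} [AddGroupWithOne I] [AddGroup J] (k : ℤ) (x : I × J) :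
    (rotation I J ^ k) x = (x.1 + k, x.2) := by
  simp [rotation, Prod.ext_iff]

theorem rotation_pow_eq_one (n : ℕ) (J : Type*) [AddGroup J] : rotation (ZMod n) J ^ n = 1 := by
  ext x : 1
  simpa [Prod.ext_iff] using rotation_zpow_apply (n : ℤ) x

theorem semiconjBy_rotation_shear {I J : Type*} [AddCommGroupWithOne I] [AddCommGroup J]
    {κ : I → J} {r s A : ℤ} (hκ : ∀ i, r • κ (i + A) = s • κ i) :
    SemiconjBy (rotation I J ^ A) (shear (.ofAdd κ) ^ s) (shear (.ofAdd κ) ^ r) := by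
  ext x : 1
  simp only [Equiv.Perm.mul_apply, shear_zpow_apply, rotation_zpow_apply, hκ]

namespace Wreath

open SemidirectProduct

variable {I J F : Type*} [AddCommGroup J] [Group F]

/-- The shear by `κ`, conjugated by the labelling `L`. -/
def labelledShear (L : I × J → F) (κ : I → J) : Wreath (I × J) F :=
  MulAut.conj (inl L) (inr (shear (.ofAdd κ)))

theorem labelledShear_zpow (L : I × J → F) (κ : I → J) (k : ℤ) :
    labelledShear L κ ^ k = inl L * inr (shear (.ofAdd κ) ^ k) * (inl L)⁻¹ := by
  rw [labelledShear, ← map_zpow, ← map_zpow, MulAut.conj_apply]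

theorem labelledShear_zpow_right (L : I × J → F) (κ : I → J) (k : ℤ) :
    (labelledShear L κ ^ k).right = shear (.ofAdd κ) ^ k := by
  simp only [labelledShear_zpow, mul_right, right_inl, right_inr, inv_right, one_mul, inv_one,
    mul_one]

theorem labelledShear_zpow_left_apply (L : I × J → F) (κ : I → J) (k : ℤ) (x : I × J) :
    (labelledShear L κ ^ k).left x = L x * (L (x.1, x.2 - k • κ x.1))⁻¹ := by
  simp only [labelledShear_zpow, ← map_inv, mul_left_apply, mul_right, left_inl, left_inr,
    right_inl, right_inr, Pi.one_apply, Pi.inv_apply, one_mul, mul_one, inv_one,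
    Equiv.Perm.one_apply, ← zpow_neg, shear_zpow_apply, neg_smul, ← sub_eq_add_neg]

variable [AddCommGroupWithOne I]

theorem commute_inr_rotation_inl {L : I × J → F} {A : ℤ} (hL : ∀ i j, L (i + A, j) = L (i, j)) :
    Commute (inr (rotation I J ^ A) : Wreath (I × J) F) (inl L) := by
  rw [Commute, SemiconjBy, ← mul_inv_eq_iff_eq_mul, ← map_inv, ← inl_aut]
  congr 1
  ext x
  change L ((rotation I J ^ A)⁻¹ x) = L x
  rw [← zpow_neg, rotation_zpow_apply, ← hL]
  simp

theorem semiconjBy_rotation_labelledShear {L : I × J → F} {κ : I → J} {r s A : ℤ}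
    (hL : ∀ i j, L (i + A, j) = L (i, j)) (hκ : ∀ i, r • κ (i + A) = s • κ i) :
    SemiconjBy (inr (rotation I J ^ A)) (labelledShear L κ ^ s) (labelledShear L κ ^ r) := by
  have hcomm := commute_inr_rotation_inl hL
  simp only [labelledShear_zpow]
  exact (SemiconjBy.mul_right hcomm ((semiconjBy_rotation_shear hκ).map inr)).mul_right
    hcomm.inv_right

theorem commutator_right_apply {L : I × J → F} {κ : I → J} {p q : ℤ} (hκ : κ 0 = κ q) :
    (labelledShear L κ ^ (-p) * inr (rotation I J ^ (-q)) * labelledShear L κ ^ p *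
      inr (rotation I J ^ q)).right (0, 0) = (0, 0) := by
  simp only [mul_right, labelledShear_zpow_right, right_inr, Equiv.Perm.mul_apply,
    rotation_zpow_apply, shear_zpow_apply]
  simp [hκ]

theorem commutator_left_apply {L : I × J → F} {κ : I → J} {p q : ℤ}
    (hL₁ : ∀ i, L (i, 0) = 1) (hL₂ : ∀ j, L (0, j) = 1) (hκ : κ 0 = κ q) :
    (labelledShear L κ ^ (-p) * inr (rotation I J ^ (-q)) * labelledShear L κ ^ p *
      inr (rotation I J ^ q)).left (0, 0) = L (q, p • κ q) := by
  simp only [mul_left_apply, mul_right, labelledShear_zpow_right, right_inr, left_inr,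
    labelledShear_zpow_left_apply, rotation_zpow_apply, shear_zpow_apply, mul_inv_rev,
    Equiv.Perm.mul_apply, ← zpow_neg]
  simp [hκ, hL₁, hL₂]

end Wreath

-- `κ` is well defined modulo `d * m` because shifting the argument by `d * m` multiplies it
-- by `v ^ m`.
theorem exists_zmod_fun_zpow_ediv {G : Type*} [Group G] {v : G} {d m : ℕ} (hd : d ≠ 0)
    (hv : v ^ m = 1) : ∃ κ : ZMod (d * m) → G, ∀ k : ℤ, κ k = v ^ (k / d) := by
  refine ⟨fun i => v ^ ((i.cast : ℤ) / d), fun k => ?_⟩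
  have hk : (((k : ZMod (d * m)).cast : ℤ)) = k + d * -(m * (k / (d * m : ℕ))) := by
    rw [ZMod.coe_intCast, Int.emod_def]
    push_cast
    ring
  dsimp only
  rw [hk, Int.add_mul_ediv_left _ _ (by exact_mod_cast hd), zpow_add, ← mul_neg, zpow_mul,
    zpow_natCast, hv, one_zpow, mul_one]

theorem zmod_natCast_eq_natCast_iff_of_lt {M a b : ℕ} (ha : a < M) (hb : b < M) :
    (a : ZMod M) = b ↔ a = b := by
  rw [ZMod.natCast_eq_natCast_iff, Nat.ModEq, Nat.mod_eq_of_lt ha, Nat.mod_eq_of_lt hb]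

theorem exists_labelling_of_three_le {d N : ℕ} (hd : 2 ≤ d) (hN : 2 ≤ N) (h : 3 ≤ d ∨ 3 ≤ N) :
    ∃ ℓ : ZMod d × ZMod N → FreeGroup (Fin 2), (∀ i, ℓ (i, 0) = 1) ∧ (∀ j, ℓ (0, j) = 1) ∧
      ∀ k, ∃ q p : ℕ, q < d ∧ ℓ (q, p) = FreeGroup.of k := by
  obtain ⟨q, p, hq, hp, hqd, hpN, hne⟩ : ∃ q p : ℕ, q ≠ 0 ∧ p ≠ 0 ∧ q < d ∧ p < N ∧
      ¬ (q = 1 ∧ p = 1) := by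
    rcases h with h | h
    exacts [⟨2, 1, by omega⟩, ⟨1, 2, by omega⟩]
  have hd₀ {a : ℕ} (ha : a ≠ 0) (had : a < d) : (0 : ZMod d) ≠ a := by
    exact_mod_cast mt (zmod_natCast_eq_natCast_iff_of_lt (by omega) had).1 ha.symm
  have hN₀ {b : ℕ} (hb : b ≠ 0) (hbN : b < N) : (0 : ZMod N) ≠ b := by
    exact_mod_cast mt (zmod_natCast_eq_natCast_iff_of_lt (by omega) hbN).1 hb.symm
  have hqp : ¬ ((q : ZMod d) = (1 : ℕ) ∧ (p : ZMod N) = (1 : ℕ)) := by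
    rwa [zmod_natCast_eq_natCast_iff_of_lt hqd hd, zmod_natCast_eq_natCast_iff_of_lt hpN hN]
  refine ⟨fun x => if x = (((1 : ℕ) : ZMod d), ((1 : ℕ) : ZMod N)) then .of 0
    else if x = ((q : ZMod d), (p : ZMod N)) then .of 1 else 1,
    fun i => ?_, fun j => ?_, fun k => ?_⟩
  · simp only [Prod.mk.injEq, hN₀ one_ne_zero hN, hN₀ hp hpN, and_false, if_false]
  · simp only [Prod.mk.injEq, hd₀ one_ne_zero hd, hd₀ hq hqd, false_and, if_false]
  · fin_cases k
    · exact ⟨1, 1, hd, if_pos rfl⟩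
    · exact ⟨q, p, hqd, (if_neg (by simpa only [Prod.mk.injEq] using hqp)).trans (if_pos rfl)⟩

namespace ExtGroup

open SemidirectProduct Wreath

variable {r : ℤ} {n : ℕ} {s A : ℤ}

theorem isLarge_of_labelling [NeZero n] {J : Type*} [AddCommGroup J] [Finite J] {κ : ZMod n → J}
    (hκ : ∀ i, r • κ (i + A) = s • κ i) {L : ZMod n × J → FreeGroup (Fin 2)}
    (hL : ∀ i j, L (i + A, j) = L (i, j)) (hL₁ : ∀ i, L (i, 0) = 1) (hL₂ : ∀ j, L (0, j) = 1)
    (hgen : ∀ k, ∃ q p : ℤ, κ 0 = κ q ∧ L (q, p • κ q) = FreeGroup.of k) :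
    IsLarge (ExtGroup r n s A) := by
  let ρ : ExtGroup r n s A →* Wreath (ZMod n × J) (FreeGroup (Fin 2)) :=
    lift (inr (rotation (ZMod n) J)) (labelledShear L κ)
      (by rw [← map_pow, rotation_pow_eq_one, map_one])
      (by rw [← map_zpow]; exact semiconjBy_rotation_labelledShear hL hκ)
  refine isLarge_of_hom ρ (0, 0) fun k => ?_
  obtain ⟨q, p, hq, hk⟩ := hgen k
  have hρ : ρ (y ^ (-p) * t ^ (-q) * y ^ p * t ^ q) =
      labelledShear L κ ^ (-p) * inr (rotation (ZMod n) J ^ (-q)) * labelledShear L κ ^ p *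
        inr (rotation (ZMod n) J ^ q) := by
    simp only [map_mul, map_zpow, ρ, lift_t, lift_y]
  exact ⟨_, hρ ▸ commutator_right_apply hq, hρ ▸ (commutator_left_apply hL₁ hL₂ hq).trans hk⟩

theorem isLarge_of_unit {d m N : ℕ} [NeZero m] [NeZero N] {A : ℤ} (hA : IsCoprime A m)
    {c : (ZMod N)ˣ} (hc : r * (c : ZMod N) = s) (hcm : c ^ m = 1) (hd : 2 ≤ d) (hN : 2 ≤ N)
    (h : 3 ≤ d ∨ 3 ≤ N) : IsLarge (ExtGroup r (d * m) s (d * A)) := by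
  have : NeZero d := ⟨by omega⟩
  obtain ⟨a, b, hab⟩ := hA
  obtain ⟨κ, hκ⟩ := exists_zmod_fun_zpow_ediv (v := c ^ a) (NeZero.ne d)
    (by rw [← zpow_natCast, zpow_comm, zpow_natCast, hcm, one_zpow])
  have hκ₁ {q : ℕ} (hq : q < d) : κ (q : ℤ) = 1 := by
    rw [hκ, Int.ediv_eq_zero_of_lt (by omega) (by omega), zpow_zero]
  have hcA : (c ^ a) ^ A = c := by
    rw [← zpow_mul, eq_sub_of_add_eq hab, zpow_sub, zpow_one, mul_comm b, zpow_mul, zpow_natCast,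
      hcm, one_zpow, inv_one, mul_one]
  obtain ⟨ℓ, hℓ₁, hℓ₂, hℓ⟩ := exists_labelling_of_three_le hd hN h
  let π : ZMod (d * m) →+* ZMod d := ZMod.castHom (Dvd.intro m rfl) (ZMod d)
  refine isLarge_of_labelling (κ := fun i => (κ i : ZMod N)) (L := fun x => ℓ (π x.1, x.2))
    (fun i => ?_) (fun i j => ?_) (fun i => hℓ₁ _) (fun j => ?_) (fun k => ?_)
  · obtain ⟨i, rfl⟩ := ZMod.intCast_surjective i
    rw [← Int.cast_add, hκ, hκ, Int.add_mul_ediv_left _ _ (by exact_mod_cast NeZero.ne d),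
      zpow_add, hcA, Units.val_mul, zsmul_eq_mul, zsmul_eq_mul, ← hc]
    ring
  · simp
  · simpa using hℓ₂ j
  · obtain ⟨q, p, hq, hk⟩ := hℓ k
    refine ⟨q, p, ?_, ?_⟩
    · rw [hκ₁ hq]; exact_mod_cast congrArg Units.val (hκ₁ (q := 0) (by omega))
    · simpa [show κ q = 1 from mod_cast hκ₁ hq] using hk

end ExtGroup

theorem exists_eq_mul_and_isCoprime {n : ℕ} (hn : n ≠ 0) (A : ℤ) :
    ∃ (d m : ℕ) (A' : ℤ), n = d * m ∧ A = d * A' ∧ IsCoprime A' m := by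
  obtain ⟨m, hm⟩ : Int.gcd n A ∣ n := Int.natCast_dvd_natCast.1 (Int.gcd_dvd_left ..)
  obtain ⟨A', hA'⟩ := Int.gcd_dvd_right (n : ℤ) A
  refine ⟨_, m, A', hm, hA', Int.gcdB n A, Int.gcdA n A, ?_⟩
  have hd : (Int.gcd n A : ℤ) ≠ 0 := by simp [hn]
  have hbezout := Int.gcd_eq_gcd_ab n A
  apply mul_left_cancel₀ hd
  have hm' : (n : ℤ) = Int.gcd n A * m := by exact_mod_cast hm
  linear_combination -hbezout - Int.gcdB n A * hA' - Int.gcdA n A * hm'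

theorem exists_dvd_of_two_le {d : ℕ} {D : ℤ} (hd : 2 ≤ d) (hD : ¬ IsUnit D)
    (h : ¬ (d = 2 ∧ D.natAbs = 2)) :
    ∃ N : ℕ, (N : ℤ) ∣ D ∧ 2 ≤ N ∧ (3 ≤ d ∨ 3 ≤ N) := by
  rcases eq_or_ne D 0 with rfl | hD0
  · exact ⟨3, dvd_zero _, by norm_num, Or.inr le_rfl⟩
  · rw [Int.isUnit_iff_natAbs_eq] at hD
    exact ⟨D.natAbs, Int.natAbs_dvd.2 dvd_rfl, by omega, by omega⟩

namespace ExtGroup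

open Subgroup

variable {r : ℤ} {n : ℕ} {s A : ℤ}

theorem isLarge_of_dvd_pow_sub_pow {d m N : ℕ} [NeZero m] (hrs : IsCoprime r s)
    (hA : IsCoprime A m) (hN : (N : ℤ) ∣ r ^ m - s ^ m) (hd : 2 ≤ d) (hN₂ : 2 ≤ N)
    (h : 3 ≤ d ∨ 3 ≤ N) : IsLarge (ExtGroup r (d * m) s (d * A)) := by
  have : NeZero N := ⟨by omega⟩
  obtain ⟨hr, hs⟩ := isCoprime_pow_sub_pow hrs (NeZero.ne m)
  have hr := hr.of_isCoprime_of_dvd_right hN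
  have hs := hs.of_isCoprime_of_dvd_right hN
  refine isLarge_of_unit hA (c := (ZMod.unitOfIsCoprime r hr)⁻¹ * ZMod.unitOfIsCoprime s hs)
    ?_ ?_ hd hN₂ h
  · rw [← ZMod.coe_unitOfIsCoprime r hr, ← Units.val_mul, mul_inv_cancel_left,
      ZMod.coe_unitOfIsCoprime]
  · rw [mul_pow, inv_pow, inv_mul_eq_one, Units.ext_iff]
    simp only [Units.val_pow_eq_pow_val, ZMod.coe_unitOfIsCoprime]
    exact_mod_cast ((ZMod.intCast_eq_intCast_iff_dvd_sub _ _ _).2 hN).symm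

theorem isLarge_of_dvd_sub {N : ℕ} (hN : (N : ℤ) ∣ r - s) (hn : 2 ≤ n) (hN₂ : 2 ≤ N)
    (h : 3 ≤ n ∨ 3 ≤ N) : IsLarge (ExtGroup r n s (n * A)) := by
  have : NeZero N := ⟨by omega⟩
  have hrs : (r : ZMod N) = s := ((ZMod.intCast_eq_intCast_iff_dvd_sub _ _ _).2 hN).symm
  have := isLarge_of_unit (r := r) (s := s) (A := A) (m := 1) (c := (1 : (ZMod N)ˣ))
    (by simpa using isCoprime_one_right) (by simp [hrs]) (one_pow 1) hn hN₂ h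
  rwa [mul_one] at this

-- `E(r, n, s, A)` maps onto the free product `ℤ/n * ℤ/k`, which is `E(k, n, 0, 0)`.
theorem isLarge_of_dvd_of_dvd {k : ℕ} (hr : (k : ℤ) ∣ r) (hs : (k : ℤ) ∣ s) (hn : 2 ≤ n)
    (hk : 2 ≤ k) (h : 3 ≤ n ∨ 3 ≤ k) : IsLarge (ExtGroup r n s A) := by
  have hlarge : IsLarge (ExtGroup k n 0 (n * 0)) := isLarge_of_dvd_sub (by simp) hn hk h
  rw [mul_zero] at hlarge
  have hy : (y : ExtGroup k n 0 0) ^ (k : ℤ) = 1 := by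
    simpa [SemiconjBy] using (semiconjBy_t_zpow (r := k) (n := n) (s := 0) (A := 0)).eq.symm
  have hrel : SemiconjBy (t ^ A) (y ^ s) (y ^ r : ExtGroup k n 0 0) := by
    obtain ⟨r, rfl⟩ := hr
    obtain ⟨s, rfl⟩ := hs
    simp only [zpow_mul, hy, one_zpow, SemiconjBy.one_right]
  exact hlarge.of_surjective (lift_surjective (ha := t_pow) (hb := hrel) closure_t_y)

theorem isOfFinOrder_t [NeZero n] : IsOfFinOrder (t : ExtGroup r n s A) :=
  isOfFinOrder_iff_pow_eq_one.2 ⟨n, NeZero.pos n, t_pow⟩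

theorem normal_zpowers_y_zpow [NeZero n] (hA : IsCoprime A n) {k : ℤ} (hrs : IsCoprime r s) :
    (zpowers (y ^ k : ExtGroup (k * r) n (k * s) A)).Normal := by
  refine normal_of_closure_eq_top closure_t_y (Set.pair_subset_iff.2 ⟨?_, ?_⟩)
  · have hrel := semiconjBy_t_zpow (r := k * r) (n := n) (s := k * s) (A := A)
    rw [zpow_mul, zpow_mul] at hrel
    have hmem := mem_normalizer_zpowers_of_semiconjBy hrs hrel (isOfFinOrder_t.zpow)
    have ht := zpowers_zpow_eq_of_isCoprime (t_zpow (r := k * r) (s := k * s) (A := A)) hA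
    exact zpowers_le.2 hmem (ht ▸ mem_zpowers t)
  · exact mem_normalizer_zpowers_of_commute ((Commute.refl y).zpow_right k)

theorem isVirtuallyAbelian_of_odd {m : ℕ} (hA : IsCoprime A m) (hr : Odd r) (hs : Odd s)
    (hy : (y : ExtGroup r (2 * m) s (2 * A)) ^ 2 = 1) :
    IsVirtuallyAbelian (ExtGroup r (2 * m) s (2 * A)) := by
  have hodd {k : ℤ} (hk : Odd k) : (y : ExtGroup r (2 * m) s (2 * A)) ^ k = y := by
    obtain ⟨k, rfl⟩ := hk
    rw [zpow_add_one, zpow_mul, zpow_ofNat, hy, one_zpow, one_mul]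
  have hrel := semiconjBy_t_zpow (r := r) (n := 2 * m) (s := s) (A := 2 * A)
  rw [hodd hr, hodd hs, zpow_mul, zpow_ofNat] at hrel
  have ht : (t ^ 2 : ExtGroup r (2 * m) s (2 * A)) ^ (m : ℤ) = 1 := by
    rw [zpow_natCast, ← pow_mul, t_pow]
  have hcomm : Commute y (t ^ 2 : ExtGroup r (2 * m) s (2 * A)) := by
    obtain ⟨k, hk⟩ := mem_zpowers_iff.1
      ((zpowers_zpow_eq_of_isCoprime ht hA).ge (mem_zpowers _))
    rw [← hk]
    exact Commute.zpow_right (Commute.symm hrel) k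
  have hnormal : (zpowers (t ^ 2 : ExtGroup r (2 * m) s (2 * A))).Normal :=
    normal_of_closure_eq_top closure_t_y <| Set.pair_subset_iff.2
      ⟨mem_normalizer_zpowers_of_commute ((Commute.refl t).pow_right 2),
        mem_normalizer_zpowers_of_commute hcomm⟩
  exact isVirtuallyAbelian_of_sq_mem_zpowers closure_t_y hnormal (mem_zpowers _)
    (hy ▸ one_mem _)

theorem y_zpow_pow_sub_pow_eq_one {d m : ℕ} :
    (y : ExtGroup r (d * m) s (d * A)) ^ (r ^ m - s ^ m) = 1 := by
  refine zpow_pow_sub_pow_eq_one semiconjBy_t_zpow ?_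
  have hdm : d * A * m = ((d * m : ℕ) : ℤ) * A := by push_cast; ring
  rw [← zpow_natCast, ← zpow_mul, hdm, zpow_mul, t_zpow, one_zpow]

theorem isVirtuallyAbelian_of_isCoprime_of_isCoprime [NeZero n] (hA : IsCoprime A n)
    (hrs : IsCoprime r s) : IsVirtuallyAbelian (ExtGroup r n s A) := by
  have hy := normal_zpowers_y_zpow (k := 1) hA hrs
  rw [zpow_one, one_mul, one_mul] at hy
  exact isVirtuallyAbelian_of_normal_zpowers closure_t_y hy

theorem isVirtuallyAbelian_of_t_eq_one (ht : (t : ExtGroup r n s A) = 1) :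
    IsVirtuallyAbelian (ExtGroup r n s A) :=
  isVirtuallyAbelian_of_normal_zpowers (Set.pair_comm t y ▸ closure_t_y)
    (by rw [ht, zpowers_one_eq_bot]; infer_instance)

theorem isVirtuallyAbelian_of_y_eq_one (hy : (y : ExtGroup r n s A) = 1) :
    IsVirtuallyAbelian (ExtGroup r n s A) :=
  isVirtuallyAbelian_of_normal_zpowers closure_t_y (by rw [hy, zpowers_one_eq_bot]; infer_instance)

theorem isLarge_or_isVirtuallyAbelian_of_isCoprime [NeZero n] (hrs : IsCoprime r s) :
    IsLarge (ExtGroup r n s A) ∨ IsVirtuallyAbelian (ExtGroup r n s A) := by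
  obtain ⟨d, m, A, rfl, rfl, hA⟩ := exists_eq_mul_and_isCoprime (NeZero.ne n) A
  have hd₀ : d ≠ 0 := left_ne_zero_of_mul (NeZero.ne (d * m))
  have : NeZero m := ⟨right_ne_zero_of_mul (NeZero.ne (d * m))⟩
  rcases eq_or_ne d 1 with rfl | hd₁
  · exact Or.inr (isVirtuallyAbelian_of_isCoprime_of_isCoprime (by simpa using hA) hrs)
  have hy := pow_natAbs_eq_one.2
    (y_zpow_pow_sub_pow_eq_one (r := r) (d := d) (m := m) (s := s) (A := A))
  by_cases hunit : IsUnit (r ^ m - s ^ m)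
  · rw [Int.isUnit_iff_natAbs_eq.1 hunit, pow_one] at hy
    exact Or.inr (isVirtuallyAbelian_of_y_eq_one hy)
  by_cases hdihedral : d = 2 ∧ (r ^ m - s ^ m).natAbs = 2
  · obtain ⟨rfl, h2⟩ := hdihedral
    rw [h2] at hy
    have h2dvd : 2 ∣ r ^ m - s ^ m := Int.natCast_dvd.2 (dvd_of_eq h2.symm)
    obtain ⟨hr, hs⟩ := isCoprime_pow_sub_pow hrs (NeZero.ne m)
    exact Or.inr <| isVirtuallyAbelian_of_odd hA
      (Int.isCoprime_two_right.1 (hr.of_isCoprime_of_dvd_right h2dvd))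
      (Int.isCoprime_two_right.1 (hs.of_isCoprime_of_dvd_right h2dvd)) hy
  · obtain ⟨N, hN, hN₂, h⟩ := exists_dvd_of_two_le (by omega) hunit hdihedral
    exact Or.inl (isLarge_of_dvd_pow_sub_pow hrs hA hN (by omega) hN₂ h)

theorem isVirtuallyAbelian_two_mul_of_odd (hA : Odd A) (hrs : IsCoprime r s) :
    IsVirtuallyAbelian (ExtGroup (2 * r) 2 (2 * s) A) := by
  refine isVirtuallyAbelian_of_sq_mem_zpowers closure_t_y
    (normal_zpowers_y_zpow (Int.isCoprime_two_right.2 hA) hrs) ?_ ?_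
  · rw [t_pow]
    exact one_mem _
  · rw [zpow_ofNat]
    exact mem_zpowers _

theorem y_zpow_sub_eq_one : (y : ExtGroup r n s (n * A)) ^ (r - s) = 1 := by
  have hy := y_zpow_pow_sub_pow_eq_one (r := r) (d := n) (m := 1) (s := s) (A := A)
  rwa [mul_one, pow_one, pow_one] at hy

theorem isVirtuallyAbelian_of_natAbs_sub_eq_two (hrs : (r - s).natAbs = 2) :
    IsVirtuallyAbelian (ExtGroup r 2 s (2 * A)) := by
  have hy := pow_natAbs_eq_one.2 (y_zpow_sub_eq_one (r := r) (n := 2) (s := s) (A := A))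
  rw [hrs] at hy
  refine isVirtuallyAbelian_of_sq_mem_zpowers (c := 1) closure_t_y
    (by rw [zpowers_one_eq_bot]; infer_instance) ?_ ?_
  · rw [t_pow]
    exact one_mem _
  · rw [hy]
    exact one_mem _

theorem isLarge_or_isVirtuallyAbelian_of_gcd_eq_two (hrs : Int.gcd r s = 2) :
    IsLarge (ExtGroup r 2 s A) ∨ IsVirtuallyAbelian (ExtGroup r 2 s A) := by
  obtain ⟨r', s', hgcd, hr, hs⟩ := Int.exists_gcd_one (hrs ▸ two_pos)
  rw [hrs, Nat.cast_ofNat, mul_comm] at hr hs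
  subst hr hs
  rcases Int.even_or_odd A with hA | hA
  · obtain ⟨A, rfl⟩ := hA.two_dvd
    by_cases h2 : (2 * r' - 2 * s').natAbs = 2
    · exact Or.inr (isVirtuallyAbelian_of_natAbs_sub_eq_two h2)
    · have hunit : ¬ IsUnit (2 * r' - 2 * s') := by
        rw [← mul_sub, Int.isUnit_iff]
        omega
      obtain ⟨N, hN, hN₂, h⟩ := exists_dvd_of_two_le le_rfl hunit fun h => h2 h.2
      exact Or.inl (isLarge_of_dvd_sub hN le_rfl hN₂ h)
  · exact Or.inr (isVirtuallyAbelian_two_mul_of_odd hA (Int.isCoprime_iff_gcd_eq_one.2 hgcd))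

theorem isLarge_or_isVirtuallyAbelian [NeZero n] :
    IsLarge (ExtGroup r n s A) ∨ IsVirtuallyAbelian (ExtGroup r n s A) := by
  by_cases hcop : IsCoprime r s
  · exact isLarge_or_isVirtuallyAbelian_of_isCoprime hcop
  rcases eq_or_ne n 1 with rfl | hn
  · exact Or.inr (isVirtuallyAbelian_of_t_eq_one (by simpa using t_pow (n := 1)))
  by_cases hfour : n = 2 ∧ Int.gcd r s = 2
  · obtain ⟨rfl, h2⟩ := hfour
    exact isLarge_or_isVirtuallyAbelian_of_gcd_eq_two h2
  · have hn₂ : 2 ≤ n := by have := NeZero.ne n; omega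
    rw [Int.isCoprime_iff_gcd_eq_one, ← Int.natAbs_natCast (Int.gcd r s),
      ← Int.isUnit_iff_natAbs_eq] at hcop
    obtain ⟨k, hk, hk₂, h⟩ := exists_dvd_of_two_le hn₂ hcop hfour
    exact Or.inl <| isLarge_of_dvd_of_dvd (hk.trans (Int.gcd_dvd_left ..))
      (hk.trans (Int.gcd_dvd_right ..)) hn₂ hk₂ h

end ExtGroup

section Shift

variable {n : ℕ}

theorem zpow_apply_of_forall_apply_add_one {G : Type*} [Group G] {φ : MulAut G} {u : ZMod n → G}
    (h : ∀ i, φ (u i) = u (i + 1)) (k : ℤ) (i : ZMod n) : (φ ^ k) (u i) = u (i + k) := by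
  induction k generalizing i with
  | zero => simp
  | succ k ih => rw [zpow_add_one, MulAut.mul_apply, h, ih]; congr 1; push_cast; ring
  | pred k ih =>
    have hinv : φ⁻¹ (u i) = u (i - 1) := by
      rw [MulAut.inv_apply, MulEquiv.symm_apply_eq, h, sub_add_cancel]
    rw [zpow_sub_one, MulAut.mul_apply, hinv, ih]; congr 1; push_cast; ring

theorem shift_zpow_of (k : ℤ) (i : ZMod n) :
    (shift n ^ k) (FreeGroup.of i) = FreeGroup.of (i + k) :=
  zpow_apply_of_forall_apply_add_one (u := FreeGroup.of) (fun i => by simp [shift]) k i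

theorem shift_pow_self : shift n ^ n = 1 := by
  apply MulEquiv.toMonoidHom_injective
  ext i
  simpa using shift_zpow_of (n : ℤ) i

theorem relators_eq_range [NeZero n] (w : FreeGroup (ZMod n)) :
    relators n w = Set.range fun k : ℤ => (shift n ^ k) w := by
  have hn : (0 : ℤ) < n := by exact_mod_cast NeZero.pos n
  refine Set.Subset.antisymm ?_ ?_
  · rintro _ ⟨k, -, rfl⟩
    exact ⟨k, by simp only [zpow_natCast]⟩
  · rintro _ ⟨k, rfl⟩
    have hmod := Int.toNat_of_nonneg (Int.emod_nonneg k hn.ne')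
    refine ⟨(k % n).toNat, ?_, ?_⟩
    · exact_mod_cast hmod ▸ Int.emod_lt_of_pos k hn
    · rw [← zpow_natCast, hmod, ← zpow_eq_zpow_emod' k shift_pow_self]

theorem image_shift_relators [NeZero n] (w : FreeGroup (ZMod n)) :
    shift n '' relators n w = relators n w := by
  rw [relators_eq_range, ← Set.range_comp]
  refine (Equiv.addLeft (1 : ℤ)).surjective.range_comp (fun k : ℤ => (shift n ^ k) w) ▸
    congrArg Set.range (funext fun k => ?_)
  simp only [Function.comp_apply, Equiv.coe_addLeft, zpow_one_add, MulAut.mul_apply]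

theorem wordM_natCast (r n k : ℕ) (f A : ℤ) :
    wordM r n k f A = block n r f * ((shift n ^ A) (block n k f))⁻¹ := by
  simp [wordM]

theorem wordM_neg_natCast (r n k : ℕ) (f A : ℤ) :
    wordM r n (-k) f A = block n r f * (shift n ^ (A + f * r)) (block n k f) := by
  rcases k.eq_zero_or_pos with rfl | hk
  · simp [wordM, block]
  · simp [wordM, hk.ne']

end Shift

section ConjLift

variable {n : ℕ} {Γ : Type*} [Group Γ]

/-- The homomorphism `ℤ/n → Γ`, `k ↦ a ^ k`, attached to an element with `a ^ n = 1`. -/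
def zmodPowersHom {a : Γ} (ha : a ^ n = 1) : Multiplicative (ZMod n) →* Γ :=
  AddMonoidHom.toMultiplicativeLeft <|
    ZMod.lift n ⟨zmultiplesHom (Additive Γ) (.ofMul a), by simp [← ofMul_pow, ha]⟩

theorem zmodPowersHom_ofAdd_intCast {a : Γ} (ha : a ^ n = 1) (k : ℤ) :
    zmodPowersHom ha (.ofAdd (k : ZMod n)) = a ^ k := by
  simp [zmodPowersHom]

/-- The homomorphism `x_i ↦ τ(i) x τ(i)⁻¹`, which turns the shift into conjugation by `τ(1)`. -/
def conjLift (τ : Multiplicative (ZMod n) →* Γ) (x : Γ) : FreeGroup (ZMod n) →* Γ :=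
  FreeGroup.lift fun i => MulAut.conj (τ (.ofAdd i)) x

variable (τ : Multiplicative (ZMod n) →* Γ) (x : Γ)

theorem map_ofAdd_intCast_zpow (k f : ℤ) :
    τ (.ofAdd (f : ZMod n)) ^ k = τ (.ofAdd ((k * f : ℤ) : ZMod n)) := by
  rw [← map_zpow, ← ofAdd_zsmul, zsmul_eq_mul, Int.cast_mul]

theorem map_ofAdd_one_zpow (k : ℤ) : τ (.ofAdd 1) ^ k = τ (.ofAdd (k : ZMod n)) := by
  simpa using map_ofAdd_intCast_zpow τ k 1

theorem monoidHom_ext_zmod {τ σ : Multiplicative (ZMod n) →* Γ}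
    (h : τ (.ofAdd 1) = σ (.ofAdd 1)) : τ = σ := by
  refine MonoidHom.ext fun i => ?_
  obtain ⟨k, hk⟩ := ZMod.intCast_surjective i.toAdd
  rw [← ofAdd_toAdd i, ← hk, ← map_ofAdd_one_zpow, ← map_ofAdd_one_zpow, h]

theorem conjLift_of (i : ZMod n) :
    conjLift τ x (FreeGroup.of i) = MulAut.conj (τ (.ofAdd i)) x :=
  FreeGroup.lift_apply_of

theorem conjLift_shift_zpow (k : ℤ) (v : FreeGroup (ZMod n)) :
    conjLift τ x ((shift n ^ k) v) = MulAut.conj (τ (.ofAdd (k : ZMod n))) (conjLift τ x v) := by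
  have hcomp : (conjLift τ x).comp (shift n ^ k).toMonoidHom =
      (MulAut.conj (τ (.ofAdd (k : ZMod n)))).toMonoidHom.comp (conjLift τ x) := by
    ext i
    simp only [MonoidHom.comp_apply, MulEquiv.toMonoidHom_eq_coe, MonoidHom.coe_coe, shift_zpow_of,
      conjLift_of, add_comm i, ofAdd_add, map_mul, MulAut.mul_apply]
  exact DFunLike.congr_fun hcomp v

theorem block_succ (n k : ℕ) (f : ℤ) :
    block n (k + 1) f = block n k f * FreeGroup.of ((k * f : ℤ) : ZMod n) := by
  simp [block, List.range_succ]

theorem conjLift_block (k : ℕ) (f : ℤ) :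
    conjLift τ x (block n k f) =
      (x * τ (.ofAdd (f : ZMod n))) ^ k * (τ (.ofAdd (f : ZMod n)) ^ k)⁻¹ := by
  induction k with
  | zero => simp [block]
  | succ k ih =>
    rw [block_succ, map_mul, ih, conjLift_of, ← map_ofAdd_intCast_zpow, zpow_natCast,
      MulAut.conj_apply, pow_succ, pow_succ']
    group

theorem conjLift_wordM {r : ℕ} {s f : ℤ} (A : ℤ) (h : f * ((r : ℤ) - s) ≡ 0 [ZMOD n]) :
    conjLift τ x (wordM r n s f A) =
      (x * τ (.ofAdd (f : ZMod n))) ^ (r : ℤ) * τ (.ofAdd (A : ZMod n)) *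
        (x * τ (.ofAdd (f : ZMod n))) ^ (-s) * (τ (.ofAdd (A : ZMod n)))⁻¹ := by
  set a := τ (.ofAdd (A : ZMod n))
  set b := x * τ (.ofAdd (f : ZMod n)) with hb
  set c := τ (.ofAdd (f : ZMod n)) ^ r with hc
  have hac : a * c = c * a := by
    rw [hc, ← zpow_natCast, map_ofAdd_intCast_zpow, ← map_mul, mul_comm, map_mul]
  have hcs : τ (.ofAdd (f : ZMod n)) ^ s = c := by
    rw [hc, ← zpow_natCast, map_ofAdd_intCast_zpow, map_ofAdd_intCast_zpow,
      (ZMod.intCast_eq_intCast_iff ..).2]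
    rw [Int.modEq_iff_dvd, ← sub_mul, mul_comm]
    exact Int.modEq_zero_iff_dvd.1 h
  obtain ⟨k, rfl | rfl⟩ := s.eq_nat_or_neg
  · rw [zpow_natCast] at hcs
    rw [wordM_natCast, map_mul, map_inv, conjLift_shift_zpow, conjLift_block, conjLift_block,
      hcs, ← hc, ← hb, MulAut.conj_apply]
    calc b ^ r * c⁻¹ * (a * (b ^ k * c⁻¹) * a⁻¹)⁻¹
        = b ^ (r : ℤ) * (c⁻¹ * (a * c)) * b ^ (-k : ℤ) * a⁻¹ := by group
      _ = b ^ (r : ℤ) * a * b ^ (-k : ℤ) * a⁻¹ := by rw [hac, inv_mul_cancel_left]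
  · rw [zpow_neg, zpow_natCast, inv_eq_iff_eq_inv] at hcs
    have hA : τ (.ofAdd ((A + f * r : ℤ) : ZMod n)) = a * c := by
      rw [hc, ← zpow_natCast, map_ofAdd_intCast_zpow, mul_comm f, Int.cast_add, ofAdd_add, map_mul]
    rw [wordM_neg_natCast, map_mul, conjLift_shift_zpow, conjLift_block, conjLift_block, hcs, ← hc,
      ← hb, MulAut.conj_apply, hA, neg_neg, zpow_natCast _ k]
    calc b ^ r * c⁻¹ * (a * c * (b ^ k * c⁻¹⁻¹) * (a * c)⁻¹)
        = b ^ (r : ℤ) * (c⁻¹ * (a * c)) * b ^ k * a⁻¹ := by group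
      _ = b ^ (r : ℤ) * a * b ^ k * a⁻¹ := by rw [hac, inv_mul_cancel_left]

theorem conjLift_wordM_eq_one_iff {r : ℕ} {s f : ℤ} (A : ℤ) (h : f * ((r : ℤ) - s) ≡ 0 [ZMOD n]) :
    conjLift τ x (wordM r n s f A) = 1 ↔ SemiconjBy (τ (.ofAdd (A : ZMod n)))
      ((x * τ (.ofAdd (f : ZMod n))) ^ s) ((x * τ (.ofAdd (f : ZMod n))) ^ (r : ℤ)) := by
  rw [conjLift_wordM τ x A h, ExtGroup.relator_eq_one_iff]

end ConjLift

namespace CycPresGroup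

variable {n : ℕ} [NeZero n]

/-- The shift automorphism `x_i ↦ x_{i+1}` of `G_n(w)`. -/
def shiftAut (w : FreeGroup (ZMod n)) : MulAut (CycPresGroup n w) :=
  QuotientGroup.congr _ _ (shift n) <| by
    exact (Subgroup.map_normalClosure _ (shift n).toMonoidHom (shift n).surjective).trans
      (congrArg Subgroup.normalClosure (image_shift_relators w))

variable {w : FreeGroup (ZMod n)}

theorem shiftAut_zpow_of (k : ℤ) (i : ZMod n) :
    (shiftAut w ^ k) (PresentedGroup.of i) = PresentedGroup.of (i + k) :=
  zpow_apply_of_forall_apply_add_one (u := PresentedGroup.of)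
    (fun i => congrArg (PresentedGroup.mk _) (by simpa using shift_zpow_of 1 i)) k i

theorem shiftAut_pow_self : shiftAut w ^ n = 1 := by
  apply MulEquiv.toMonoidHom_injective
  ext i
  simpa using shiftAut_zpow_of (w := w) (n : ℤ) i

/-- The action of `ℤ/n` on `G_n(w)` by powers of the shift. -/
def shiftAction (w : FreeGroup (ZMod n)) : Multiplicative (ZMod n) →* MulAut (CycPresGroup n w) :=
  zmodPowersHom shiftAut_pow_self

theorem shiftAction_of (i j : ZMod n) :
    shiftAction w (.ofAdd i) (PresentedGroup.of j) = PresentedGroup.of (j + i) := by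
  obtain ⟨i, rfl⟩ := ZMod.intCast_surjective i
  rw [shiftAction, zmodPowersHom_ofAdd_intCast, shiftAut_zpow_of]

end CycPresGroup

open CycPresGroup SemidirectProduct

/-- The shift extension `G_n(w) ⋊ ℤ/n`, in which `1 ∈ ℤ/n` acts on `G_n(w)` as the shift. -/
abbrev ShiftExtension (n : ℕ) [NeZero n] (w : FreeGroup (ZMod n)) : Type :=
  CycPresGroup n w ⋊[shiftAction w] Multiplicative (ZMod n)

namespace ShiftExtension

variable {n : ℕ} [NeZero n] {w : FreeGroup (ZMod n)} {Γ : Type*} [Group Γ]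

theorem inl_of (i : ZMod n) : (inl (PresentedGroup.of i) : ShiftExtension n w) =
    MulAut.conj (inr (.ofAdd i)) (inl (PresentedGroup.of 0)) := by
  rw [MulAut.conj_apply, ← map_inv, ← inl_aut, shiftAction_of, zero_add]

theorem conjLift_inr_inl : conjLift (inr : _ →* ShiftExtension n w) (inl (PresentedGroup.of 0)) =
    inl.comp (PresentedGroup.mk (relators n w)) := by
  ext1 i
  exact (conjLift_of ..).trans (inl_of i).symm

theorem conjLift_inr_inl_self :
    conjLift (inr : _ →* ShiftExtension n w) (inl (PresentedGroup.of 0)) w = 1 := by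
  have hw : w ∈ relators n w := by
    rw [relators_eq_range]
    exact ⟨0, rfl⟩
  rw [conjLift_inr_inl, MonoidHom.comp_apply, PresentedGroup.one_of_mem hw, map_one]

/-- The homomorphism `x_0 ↦ x`, `i ↦ τ(i)` given by the universal property of the shift
extension. -/
def lift (τ : Multiplicative (ZMod n) →* Γ) (x : Γ) (hx : conjLift τ x w = 1) :
    ShiftExtension n w →* Γ :=
  SemidirectProduct.lift
    (PresentedGroup.toGroup (f := fun i => MulAut.conj (τ (.ofAdd i)) x) <| by
      rw [relators_eq_range]
      rintro _ ⟨k, rfl⟩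
      exact (conjLift_shift_zpow τ x k w).trans (by rw [hx, map_one])) τ fun i => by
    ext j
    obtain ⟨i, rfl⟩ := Multiplicative.ofAdd.surjective i
    simp [shiftAction_of, add_comm j, mul_assoc]

variable {τ : Multiplicative (ZMod n) →* Γ} {x : Γ} {hx : conjLift τ x w = 1}

@[simp]
theorem lift_inl_of_zero : lift τ x hx (inl (PresentedGroup.of 0)) = x := by
  simp [lift]

@[simp]
theorem lift_inr (i : Multiplicative (ZMod n)) : lift τ x hx (inr i) = τ i := by
  simp [lift]

theorem hom_ext {φ ψ : ShiftExtension n w →* Γ}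
    (hx : φ (inl (PresentedGroup.of 0)) = ψ (inl (PresentedGroup.of 0)))
    (hτ : φ (inr (.ofAdd 1)) = ψ (inr (.ofAdd 1))) : φ = ψ := by
  have hr : φ.comp inr = ψ.comp inr := by
    exact monoidHom_ext_zmod hτ
  refine SemidirectProduct.hom_ext ?_ hr
  ext i
  have hi := DFunLike.congr_fun hr (.ofAdd i)
  simp only [MonoidHom.comp_apply] at hi
  rw [MonoidHom.comp_apply, MonoidHom.comp_apply, inl_of]
  simp only [MulAut.conj_apply, map_mul, map_inv, hx, hi]

end ShiftExtension

namespace ExtGroup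

variable {r n : ℕ} [NeZero n] {s f : ℤ}

section ShiftExtension

variable (A : ℤ) (h : f * ((r : ℤ) - s) ≡ 0 [ZMOD n])

/-- The homomorphism from `E(r, n, s, A)` to the shift extension of `G_n(w)` with `t ↦ 1 ∈ ℤ/n`
and `y ↦ x_0 t^f`. -/
def toShiftExtension : ExtGroup r n s A →* ShiftExtension n (wordM r n s f A) :=
  lift (inr (.ofAdd 1)) (inl (PresentedGroup.of 0) * inr (.ofAdd (f : ZMod n)))
    (by rw [← zpow_natCast, map_ofAdd_one_zpow]; simp)
    (by
      rw [map_ofAdd_one_zpow]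
      exact (conjLift_wordM_eq_one_iff _ _ A h).1 ShiftExtension.conjLift_inr_inl_self)

@[simp]
theorem toShiftExtension_t : toShiftExtension A h t = inr (.ofAdd 1) := lift_t

@[simp]
theorem toShiftExtension_y :
    toShiftExtension A h y = inl (PresentedGroup.of 0) * inr (.ofAdd (f : ZMod n)) := lift_y

/-- The homomorphism from the shift extension of `G_n(w)` to `E(r, n, s, A)` with `1 ∈ ℤ/n ↦ t`
and `x_0 ↦ y t^{-f}`. -/
def ofShiftExtension : ShiftExtension n (wordM r n s f A) →* ExtGroup r n s A :=
  ShiftExtension.lift (zmodPowersHom t_pow) (y * (t ^ f)⁻¹) <| by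
    rw [conjLift_wordM_eq_one_iff _ _ A h]
    simp only [zmodPowersHom_ofAdd_intCast, inv_mul_cancel_right]
    exact semiconjBy_t_zpow

@[simp]
theorem ofShiftExtension_inl_of_zero :
    ofShiftExtension A h (inl (PresentedGroup.of 0)) = y * (t ^ f)⁻¹ :=
  ShiftExtension.lift_inl_of_zero

@[simp]
theorem ofShiftExtension_inr_intCast (k : ℤ) :
    ofShiftExtension A h (inr (.ofAdd (k : ZMod n))) = t ^ k := by
  rw [ofShiftExtension, ShiftExtension.lift_inr, zmodPowersHom_ofAdd_intCast]

@[simp]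
theorem ofShiftExtension_inr_one : ofShiftExtension A h (inr (.ofAdd 1)) = t := by
  simpa using ofShiftExtension_inr_intCast A h 1

/-- `E(r, n, s, A)` is the shift extension of `G_n(w)`. -/
def shiftExtensionEquiv : ExtGroup r n s A ≃* ShiftExtension n (wordM r n s f A) :=
  MonoidHom.toMulEquiv (toShiftExtension A h) (ofShiftExtension A h)
    (hom_ext (by simp) (by simp))
    (ShiftExtension.hom_ext (by simp [map_ofAdd_one_zpow]) (by simp))

theorem rightHom_comp_toShiftExtension :
    rightHom.comp (toShiftExtension A h) = retraction A h := by
  refine hom_ext ?_ ?_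
  · rw [MonoidHom.comp_apply, toShiftExtension_t, rightHom_inr]
    exact (PresentedGroup.toGroup.of (retractionGen_relators A h) (x := Gen.t)).symm
  · rw [MonoidHom.comp_apply, toShiftExtension_y, map_mul, rightHom_inl, rightHom_inr, one_mul]
    exact (PresentedGroup.toGroup.of (retractionGen_relators A h) (x := Gen.y)).symm

/-- The isomorphism `G_n(w) ≃ ker ν^f` with `x_i ↦ t^i y t^{-f} t^{-i}`. -/
noncomputable def cycPresGroupEquivKerRetraction :
    CycPresGroup n (wordM r n s f A) ≃* (retraction A h).ker :=
  let ι := (shiftExtensionEquiv A h).symm.toMonoidHom.comp inl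
  have hι : Function.Injective ι := (shiftExtensionEquiv A h).symm.injective.comp inl_injective
  have hrange : ι.range = (retraction A h).ker := by
    rw [MonoidHom.range_comp, range_inl_eq_ker_rightHom, ← rightHom_comp_toShiftExtension,
      ← MonoidHom.comap_ker]
    exact Subgroup.map_equiv_eq_comap_symm' _ _
  (MonoidHom.ofInjective hι).trans (MulEquiv.subgroupCongr hrange)

end ShiftExtension

theorem isLarge_or_isVirtuallyAbelian_ker_retraction {r : ℤ} (A : ℤ)
    (h : f * (r - s) ≡ 0 [ZMOD n]) :
    IsLarge (retraction A h).ker ∨ IsVirtuallyAbelian (retraction A h).ker :=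
  have : Finite (Multiplicative (ZMod n)) := inferInstanceAs (Finite (ZMod n))
  isLarge_or_isVirtuallyAbelian_subgroup isLarge_or_isVirtuallyAbelian _

end ExtGroup

theorem CycPresGroup.isLarge_or_isVirtuallyAbelian_wordM {r n : ℕ} [NeZero n] {s f : ℤ} (A : ℤ)
    (h : f * ((r : ℤ) - s) ≡ 0 [ZMOD n]) :
    IsLarge (CycPresGroup n (wordM r n s f A)) ∨
      IsVirtuallyAbelian (CycPresGroup n (wordM r n s f A)) :=
  (isLarge_or_isVirtuallyAbelian_congr (ExtGroup.cycPresGroupEquivKerRetraction A h)).2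
    (ExtGroup.isLarge_or_isVirtuallyAbelian_ker_retraction A h)

theorem IsTypeM.exists_wordM {G : Type*} [Group G] (hG : IsTypeM G) :
    ∃ (r n : ℕ) (s f A : ℤ), 0 < n ∧ f * ((r : ℤ) - s) ≡ 0 [ZMOD n] ∧
      Nonempty (G ≃* CycPresGroup n (wordM r n s f A)) := by
  obtain ⟨n, r₁, r₂, a, f, ε, hn, -, hf, e⟩ := hG
  rcases Int.units_eq_one_or ε with rfl | rfl
  · refine ⟨r₁, n, -r₂, f, a - f * r₁, hn, ?_, ?_⟩
    · simpa [mul_comm f] using hf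
    · rw [Units.val_one, zpow_one] at e
      rwa [wordM_neg_natCast, sub_add_cancel, zpow_natCast]
  · refine ⟨r₁, n, r₂, f, a, hn, ?_, ?_⟩
    · simpa [mul_comm f, sub_eq_add_neg] using hf
    · rw [Units.val_neg, Units.val_one, zpow_neg_one] at e
      rwa [wordM_natCast, zpow_natCast]

end CycPres

theorem mainTheorem10 :
    (∀ (r n : ℕ) (s f A : ℤ), 0 < n → ∀ h : f * ((r : ℤ) - s) ≡ 0 [ZMOD n],
      (CycPres.IsLarge (CycPres.ExtGroup r n s A) ∨
        CycPres.IsVirtuallyAbelian (CycPres.ExtGroup r n s A)) ∧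
      (CycPres.IsLarge (CycPres.retraction A h).ker ∨
        CycPres.IsVirtuallyAbelian (CycPres.retraction A h).ker) ∧
      (CycPres.IsLarge (CycPres.CycPresGroup n (CycPres.wordM r n s f A)) ∨
        CycPres.IsVirtuallyAbelian (CycPres.CycPresGroup n (CycPres.wordM r n s f A)))) ∧
    (∀ (G : Type*) [Group G], CycPres.IsTypeM G →
      CycPres.IsLarge G ∨ CycPres.IsVirtuallyAbelian G) := by
  refine ⟨fun r n s f A hn h => ?_, fun G _ hG => ?_⟩
  · have : NeZero n := ⟨hn.ne'⟩
    exact ⟨CycPres.ExtGroup.isLarge_or_isVirtuallyAbelian,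
      CycPres.ExtGroup.isLarge_or_isVirtuallyAbelian_ker_retraction A h,
      CycPres.CycPresGroup.isLarge_or_isVirtuallyAbelian_wordM A h⟩
  · obtain ⟨r, n, s, f, A, hn, h, ⟨e⟩⟩ := hG.exists_wordM
    have : NeZero n := ⟨hn.ne'⟩
    exact (CycPres.isLarge_or_isVirtuallyAbelian_congr e).2
      (CycPres.CycPresGroup.isLarge_or_isVirtuallyAbelian_wordM A h)
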